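/- Let $\gamma$ be a probability measure on $\mathbb{R}$ with Jacobi parameters $\{a_n,b_n\}_{n\ge1}$: all moments of $\gamma$ are finite and its orthonormal polynomials $p_n$ (degree $n$, positive leading coefficient) obey $xp_n=a_{n+1}p_{n+1}+b_{n+1}p_n+a_np_{n-1}$, $p_{-1}=0$. Let $J$ be the semi-infinite Jacobi matrix with diagonal $b_1,b_2,\dots$ and off-diagonal $a_1,a_2,\dots$. Let $\mathbb{D}=\{z\in\mathbb{C}:|z|<1\}$. A function $u$ is a Jost function of $\gamma$ if: (i) for $z\in\mathbb{D}\setminus\{0\}$, $u(z)=0$ if and only if $z+z^{-1}$ is an eigenvalue of $J$ (with eigenvector in $\ell^2$); (ii) the singular part of $\gamma$ is supported on a finite set of eigenvalues of $J$ in $\mathbb{R}\setminus[-2,2]$, and the absolutely continuous part of $\gamma$ is $f(x)\,dx$ on $[-2,2]$, where $f(2\cos\theta)=\frac1\pi\,\frac{|\sin\theta|}{|u(e^{i\theta})|^2}$ for all real $\theta$; (iii) $u(0)>0$. For a nontrivial (not finitely supported) probability measure $\mu$ on $\partial\mathbb{D}$ that is invariant under $z\mapsto\bar z$, let $\Phi_n$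 be its monic orthogonal polynomials, and let its Verblunsky coefficients $\alpha_n$ be defined by $\Phi_{n+1}(z)=z\Phi_n(z)-\bar\alpha_n\Phi_n^*(z)$, $\Phi_n^*(z)=z^n\overline{\Phi_n(1/\bar z)}$. The second Szegő map is $$d\,\mathrm{Sz}_2(\mu)(x)=c^2(4-x^2)\,d\,\mathrm{Sz}_1(\mu)(x),\qquad c=[2(1-|\alpha_0|^2)(1-\alpha_1)]^{-1/2},$$ where $\mathrm{Sz}_1(\mu)$ is the image of $\mu$ under $e^{i\theta}\mapsto 2\cos\theta$. Thus, for $d\mu=w(\theta)\frac{d\theta}{2\pi}$ with $w$ even, $\mathrm{Sz}_2(\mu)=\pi^{-1}c^2(4-x^2)^{1/2}\,w(\arccos(x/2))\,dx$ on $[-2,2]$. **Proposition 3.1.** If $\gamma$ has a Jost function $u$ that is analytic in a neighborhood of $\overline{\mathbb{D}}$ and nonvanishing on $\overline{\mathbb{D}}$, then $\gamma\in\operatorname{ran}(\mathrm{Sz}_2)$ and $\int_{-2}^2(4-x^2)^{-1}\,d\gamma(x)<\infty$. These two conclusions are equivalent in general: for every nontrivial probability measure $\gamma$ on $[-2,2]$,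 $\gamma\in\operatorname{ran}(\mathrm{Sz}_2)$ if and only if $\int_{-2}^2(4-x^2)^{-1}\,d\gamma(x)<\infty$ (with $(4-x^2)^{-1}=+\infty$ at $x=\pm2$). -/

import Mathlib

open MeasureTheory Polynomial

noncomputable section

/-! ### Orthogonal polynomials on the real line, Jacobi matrices -/

/-- `a n = a_{n+1}` and `b n = b_{n+1}` (`n = 0, 1, …`) are the Jacobi parameters of `γ`: all
moments of `γ` are finite, and the orthonormal polynomials `p n` of `γ` (degree `n`, positive
leading coefficient) obey `x p_n = a_{n+1} p_{n+1} + b_{n+1} p_n + a_n p_{n-1}`, `p_{-1} = 0`. -/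
def IsJacobiParameters (γ : Measure ℝ) (a b : ℕ → ℝ) : Prop :=
  (∀ n : ℕ, Integrable (fun x : ℝ => x ^ n) γ) ∧
  ∃ p : ℕ → ℝ[X],
    (∀ n, (p n).natDegree = n ∧ 0 < (p n).leadingCoeff) ∧
    (∀ m n, ∫ x, (p m).eval x * (p n).eval x ∂γ = if m = n then 1 else 0) ∧
    (∀ x, x * (p 0).eval x = a 0 * (p 1).eval x + b 0 * (p 0).eval x) ∧
    (∀ n x, x * (p (n + 1)).eval x =
      a (n + 1) * (p (n + 2)).eval x + b (n + 1) * (p (n + 1)).eval x + a n * (p n).eval x)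

/-- `E` is an eigenvalue, with an eigenvector in `ℓ²`, of the semi-infinite tridiagonal matrix `J`
with diagonal `b 0, b 1, …` and off-diagonal `a 0, a 1, …`. -/
def IsJacobiEigenvalue (a b : ℕ → ℝ) (E : ℂ) : Prop :=
  ∃ ψ : ℕ → ℂ, ψ ≠ 0 ∧ Memℓp ψ 2 ∧
    b 0 * ψ 0 + a 0 * ψ 1 = E * ψ 0 ∧
    ∀ n, a n * ψ n + b (n + 1) * ψ (n + 1) + a (n + 1) * ψ (n + 2) = E * ψ (n + 1)

/-- The three facts that define a Jost function `u` of the measure `γ` with Jacobi parameters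
`a`, `b`.  (The requirement that `u` be analytic near the closed unit disk is kept separate.) -/
structure IsJostFunction (γ : Measure ℝ) (a b : ℕ → ℝ) (u : ℂ → ℂ) : Prop where
  /-- In the open unit disk, `u z = 0` exactly when `z + z⁻¹` is an eigenvalue of `J`
  (at `z = 0`, where `z + z⁻¹ = ∞`, there is nothing to say). -/
  zero_iff : ∀ z : ℂ, ‖z‖ < 1 → z ≠ 0 → (u z = 0 ↔ IsJacobiEigenvalue a b (z + z⁻¹))
  /-- The singular part of `γ` lives on a finite set of eigenvalues of `J` outside `[-2, 2]`. -/
  singular : ∃ S : Finset ℝ, (∀ E ∈ S, E ∉ Set.Icc (-2 : ℝ) 2 ∧ IsJacobiEigenvalue a b (E : ℂ)) ∧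
    γ.singularPart volume (S : Set ℝ)ᶜ = 0
  /-- The absolutely continuous part of `γ` is `f(x) dx` on `[-2, 2]`, where
  `f (2 cos θ) = π⁻¹ |sin θ| / |u(e^{iθ})|²`. -/
  density : ∃ f : ℝ → ℝ,
    (∀ θ : ℝ, f (2 * Real.cos θ) =
      1 / Real.pi * (|Real.sin θ| / ‖u (Complex.exp (θ * Complex.I))‖ ^ 2)) ∧
    γ = (volume.restrict (Set.Icc (-2 : ℝ) 2)).withDensity (fun x => ENNReal.ofReal (f x))
      + γ.singularPart volume
  /-- `u(0) > 0`. -/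
  pos_zero : (u 0).im = 0 ∧ 0 < (u 0).re

/-! ### Orthogonal polynomials on the unit circle -/

/-- The Borel sets of the unit circle. -/
instance : MeasurableSpace Circle := borel Circle

instance : BorelSpace Circle := ⟨rfl⟩

/-- A measure is nontrivial if it is not concentrated on a finite set. -/
def IsNontrivialMeasure {X : Type*} [MeasurableSpace X] (μ : Measure X) : Prop :=
  ∀ S : Set X, S.Finite → μ Sᶜ ≠ 0

/-- `P` is the monic polynomial of degree `n` that is orthogonal to `1, z, …, z^{n-1}` in
`L²(μ)`. -/
def IsMonicOPUC (μ : Measure Circle) (n : ℕ) (P : ℂ[X]) : Prop :=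
  P.Monic ∧ P.natDegree = n ∧
    ∀ j < n, ∫ z : Circle, (starRingEnd ℂ) ((z : ℂ) ^ j) * P.eval (z : ℂ) ∂μ = 0

/-- `α` is the `n`-th Verblunsky coefficient of `μ`: the monic orthogonal polynomials obey
`Φ_{n+1}(z) = z Φ_n(z) - conj(α) Φ_n^*(z)`, where `Φ_n^*(z) = zⁿ conj(Φ_n(1 / conj z))`. -/
def IsVerblunsky (μ : Measure Circle) (n : ℕ) (α : ℂ) : Prop :=
  ∃ P Q : ℂ[X], IsMonicOPUC μ n P ∧ IsMonicOPUC μ (n + 1) Q ∧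
    ∀ z : ℂ, z ≠ 0 → Q.eval z = z * P.eval z -
      (starRingEnd ℂ) α * (z ^ n * (starRingEnd ℂ) (P.eval (1 / (starRingEnd ℂ) z)))

/-- The `n`-th Verblunsky coefficient; it exists and is unique for nontrivial probability
measures. -/
def verblunsky (μ : Measure Circle) (n : ℕ) : ℂ :=
  Classical.epsilon (IsVerblunsky μ n)

/-- The nontrivial probability measures on the unit circle that are invariant under
`z ↦ conj z` (which is `z ↦ z⁻¹` on the circle). -/
def evenMeasures : Set (Measure Circle) :=
  {μ | IsProbabilityMeasure μ ∧ IsNontrivialMeasure μ ∧ μ.map (fun z => z⁻¹) = μ}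

/-- The first Szegő map: the image of `μ` under `e^{iθ} ↦ 2 cos θ`.  On `w(θ) dθ/2π`, with `w`
even, it gives `π⁻¹ (4 - x²)^{-1/2} w(arccos(x/2)) dx` on `[-2, 2]`. -/
def Sz₁ (μ : Measure Circle) : Measure ℝ :=
  μ.map (fun z : Circle => 2 * (z : ℂ).re)

/-- The constant `c = [2 (1 - |α₀|²) (1 - α₁)]^{-1/2}`.  (Even measures have real
Verblunsky coefficients, so the real part changes nothing.) -/
def szegoConst (μ : Measure Circle) : ℝ :=
  (2 * (1 - ‖verblunsky μ 0‖ ^ 2) * (1 - (verblunsky μ 1).re)) ^ (-(1 / 2) : ℝ)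

/-- The second Szegő map: `Sz₂(μ) = c² (4 - x²) Sz₁(μ)`.  On `w(θ) dθ/2π`, with `w`
even, it gives `π⁻¹ c² (4 - x²)^{1/2} w(arccos(x/2)) dx` on `[-2, 2]`. -/
def Sz₂ (μ : Measure Circle) : Measure ℝ :=
  (Sz₁ μ).withDensity (fun x => ENNReal.ofReal (szegoConst μ ^ 2 * (4 - x ^ 2)))

/-- The range of the second Szegő map. -/
def ranSz₂ : Set (Measure ℝ) := Sz₂ '' evenMeasures

end

/-! Up to a constant, `Sz₂` projects a measure to `[-2, 2]` and multiplies it by `4 - x²`. Points of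
the range thus have finite `(4 - x²)⁻¹`-integral, the product of the two factors being at most 1.
Conversely, normalize `(4 - x²)⁻¹ γ` and lift it symmetrically to the circle (`szegoLift`); `Sz₂` of
the lift is a multiple of `γ`. The multiple is 1 without computing any Verblunsky coefficient of the
lift, since `Sz₂` always has total mass one (`szegoConst_sq`). For a nonvanishing Jost function,
eigenvalues outside `[-2, 2]` would give zeros in the disk, so `γ` has no singular part; a lower
bound for `|u|` bounds the density by `K √(4 - x²)`, and `(4 - x²)^(-1/2)` is integrable. -/

namespace Circle

theorem integrable_of_continuous {E : Type*} [NormedAddCommGroup E] (μ : Measure Circle)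
    [IsFiniteMeasure μ] {f : Circle → E} (hf : Continuous f) : Integrable f μ :=
  hf.integrable_of_hasCompactSupport (HasCompactSupport.of_compactSpace f)

theorem integral_pos_of_finite_zeros {μ : Measure Circle} [IsFiniteMeasure μ]
    (hμ : IsNontrivialMeasure μ) {f : Circle → ℝ} (hf : Continuous f) (h0 : ∀ z, 0 ≤ f z)
    (hfin : {z | f z = 0}.Finite) : 0 < ∫ z, f z ∂μ := by
  rw [integral_pos_iff_support_of_nonneg h0 (integrable_of_continuous μ hf)]
  exact pos_iff_ne_zero.2 (hμ _ hfin)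

theorem finite_setOf_re_eq (r : ℝ) : {z : Circle | (z : ℂ).re = r}.Finite := by
  refine Set.Finite.of_finite_image (f := fun z : Circle => (z : ℂ).im) ?_ ?_
  · refine ((Set.finite_singleton (Real.sqrt (1 - r ^ 2))).union
      (Set.finite_singleton (-Real.sqrt (1 - r ^ 2)))).subset ?_
    rintro _ ⟨z, hz, rfl⟩
    have h1 : (z : ℂ).re ^ 2 + (z : ℂ).im ^ 2 = 1 := by
      have := Circle.normSq_coe z
      rw [Complex.normSq_apply] at this; nlinarith
    have hz' : (z : ℂ).re = r := hz
    rw [hz'] at h1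
    have h2 : 1 - r ^ 2 = (z : ℂ).im ^ 2 := by linarith
    simp only [Set.mem_union, Set.mem_singleton_iff]
    rw [h2, Real.sqrt_sq_eq_abs]
    rcases abs_choice (z : ℂ).im with h | h <;> rw [h] <;> simp
  · intro z hz w hw h
    exact Circle.ext (Complex.ext ((show (z : ℂ).re = r from hz).trans
      (show (w : ℂ).re = r from hw).symm) h)

theorem re_sq_add_im_sq (z : Circle) : (z : ℂ).re ^ 2 + (z : ℂ).im ^ 2 = 1 := by
  have := Circle.normSq_coe z
  rw [Complex.normSq_apply] at this
  nlinarith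

end Circle

/-! ### Moments of even measures and the first two Verblunsky coefficients -/

section Verblunsky

variable {μ : Measure Circle}

theorem conj_moment_of_even (hμ : μ.map (fun z => z⁻¹) = μ) (n : ℕ) :
    (starRingEnd ℂ) (∫ z : Circle, (z : ℂ) ^ n ∂μ) = ∫ z : Circle, (z : ℂ) ^ n ∂μ := by
  conv_rhs => rw [← hμ]
  rw [integral_map (by fun_prop) (by fun_prop), ← integral_conj]
  simp only [Circle.coe_inv_eq_conj, map_pow]

theorem ofReal_integral_re_of_even [IsFiniteMeasure μ] (hμ : μ.map (fun z => z⁻¹) = μ) (n : ℕ) :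
    ((∫ z : Circle, ((z : ℂ) ^ n).re ∂μ : ℝ) : ℂ) = ∫ z : Circle, (z : ℂ) ^ n ∂μ := by
  have h := Complex.conj_eq_iff_re.1 (conj_moment_of_even hμ n)
  rw [← h]
  congr 1
  exact integral_re (Circle.integrable_of_continuous μ (f := fun z : Circle => (z : ℂ) ^ n)
    (by fun_prop))

theorem isMonicOPUC_zero (μ : Measure Circle) : IsMonicOPUC μ 0 1 :=
  ⟨monic_one, natDegree_one, fun _ h => absurd h (Nat.not_lt_zero _)⟩

theorem IsMonicOPUC.eq_one {P : ℂ[X]} (h : IsMonicOPUC μ 0 P) : P = 1 :=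
  h.1.natDegree_eq_zero.1 h.2.1

theorem IsMonicOPUC.integral_eval {n : ℕ} {P : ℂ[X]} (h : IsMonicOPUC μ (n + 1) P) :
    ∫ z : Circle, P.eval (z : ℂ) ∂μ = 0 := by
  simpa using h.2.2 0 n.succ_pos

variable [IsProbabilityMeasure μ]

theorem integral_circle_quadratic (a b c : ℂ) :
    ∫ z : Circle, (a * (z : ℂ) ^ 2 + b * (z : ℂ) + c) ∂μ =
      a * (∫ z : Circle, (z : ℂ) ^ 2 ∂μ) + b * (∫ z : Circle, (z : ℂ) ∂μ) + c := by
  have h2 := Circle.integrable_of_continuous μ (f := fun z : Circle => a * (z : ℂ) ^ 2)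
    (by fun_prop)
  have h1 := Circle.integrable_of_continuous μ (f := fun z : Circle => b * (z : ℂ))
    (by fun_prop)
  have h21 := Circle.integrable_of_continuous μ
    (f := fun z : Circle => a * (z : ℂ) ^ 2 + b * (z : ℂ)) (by fun_prop)
  rw [integral_add h21 (integrable_const c), integral_add h2 h1,
    integral_const_mul, integral_const_mul]
  simp

theorem isMonicOPUC_one (μ : Measure Circle) [IsProbabilityMeasure μ] :
    IsMonicOPUC μ 1 (X - C (∫ z : Circle, (z : ℂ) ∂μ)) := by
  refine ⟨monic_X_sub_C _, natDegree_X_sub_C _, fun j hj => ?_⟩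
  obtain rfl : j = 0 := by omega
  have := integral_circle_quadratic (μ := μ) 0 1 (-∫ z : Circle, (z : ℂ) ∂μ)
  simpa [sub_eq_add_neg] using this

theorem IsMonicOPUC.eq_X_sub_C {P : ℂ[X]} (h : IsMonicOPUC μ 1 P) :
    P = X - C (∫ z : Circle, (z : ℂ) ∂μ) := by
  have hP : P = X + C (P.coeff 0) := h.1.eq_X_add_C h.2.1
  have h0 := h.integral_eval
  have := integral_circle_quadratic (μ := μ) 0 1 (P.coeff 0)
  rw [hP] at h0
  simp only [eval_add, eval_X, eval_C] at h0
  simp only [zero_mul, zero_add, one_mul, h0] at this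
  rw [hP, sub_eq_add_neg, ← C_neg]
  congr 2
  simpa using eq_neg_of_add_eq_zero_right this.symm

theorem isVerblunsky_zero_iff {α : ℂ} :
    IsVerblunsky μ 0 α ↔ (starRingEnd ℂ) α = ∫ z : Circle, (z : ℂ) ∂μ := by
  constructor
  · rintro ⟨P, Q, hP, hQ, h⟩
    have := h 1 one_ne_zero
    rw [hP.eq_one, hQ.eq_X_sub_C] at this
    simpa using this.symm
  · intro h
    exact ⟨1, _, isMonicOPUC_zero μ, isMonicOPUC_one μ, fun z _ => by simp [h]⟩

theorem verblunsky_zero :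
    (starRingEnd ℂ) (verblunsky μ 0) = ∫ z : Circle, (z : ℂ) ∂μ :=
  isVerblunsky_zero_iff.1 (Classical.epsilon_spec (p := IsVerblunsky μ 0)
    ⟨(starRingEnd ℂ) (∫ z : Circle, (z : ℂ) ∂μ), isVerblunsky_zero_iff.2 (by simp)⟩)

/-- Integrate the recursion for `Φ₂`: its integral vanishes, and the right side is a quadratic in
`z` on the circle. -/
theorem IsVerblunsky.one_mul_eq {α : ℂ} (h : IsVerblunsky μ 1 α) :
    (starRingEnd ℂ) α * (1 - (starRingEnd ℂ) (∫ z : Circle, (z : ℂ) ∂μ) *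
      ∫ z : Circle, (z : ℂ) ∂μ) =
      (∫ z : Circle, (z : ℂ) ^ 2 ∂μ) - (∫ z : Circle, (z : ℂ) ∂μ) ^ 2 := by
  obtain ⟨P, Q, hP, hQ, h⟩ := h
  have h0 := hQ.integral_eval
  set m := ∫ z : Circle, (z : ℂ) ∂μ with hm
  have key := integral_circle_quadratic (μ := μ) 1
    (-m + (starRingEnd ℂ) α * (starRingEnd ℂ) m) (-(starRingEnd ℂ) α)
  have : ∀ z : Circle, Q.eval (z : ℂ) = 1 * (z : ℂ) ^ 2 +
      (-m + (starRingEnd ℂ) α * (starRingEnd ℂ) m) * (z : ℂ) + -(starRingEnd ℂ) α := by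
    intro z
    rw [h z (Circle.coe_ne_zero z), hP.eq_X_sub_C, ← hm]
    have hz := Circle.coe_ne_zero z
    simp only [eval_sub, eval_X, eval_C, map_sub, map_div₀, map_one, Complex.conj_conj, pow_one]
    field_simp
    ring
  simp_rw [this] at h0
  rw [h0] at key
  linear_combination key

/-- The recursion produces the monic orthogonal polynomial of degree two when the first moment
is real. -/
theorem isVerblunsky_one_of_mul_eq {α m : ℂ} (hm : ∫ z : Circle, (z : ℂ) ∂μ = m)
    (hreal : (starRingEnd ℂ) m = m)
    (h : (starRingEnd ℂ) α * (1 - m * m) = (∫ z : Circle, (z : ℂ) ^ 2 ∂μ) - m ^ 2) :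
    IsVerblunsky μ 1 α := by
  refine ⟨X - C m, X ^ 2 + C (-m + (starRingEnd ℂ) α * m) * X + C (-(starRingEnd ℂ) α),
    hm ▸ isMonicOPUC_one μ, ⟨?_, ?_, ?_⟩, ?_⟩
  · monicity!
  · compute_degree!
  · intro j hj
    obtain rfl | rfl : j = 0 ∨ j = 1 := by omega
    · have := integral_circle_quadratic (μ := μ) 1 (-m + (starRingEnd ℂ) α * m)
        (-(starRingEnd ℂ) α)
      rw [hm] at this
      simp only [pow_zero, map_one, one_mul, eval_add, eval_pow, eval_X, eval_mul, eval_C] at this ⊢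
      rw [this]
      linear_combination -h
    -- Orthogonality to `z` holds for every `α` because `m` is real; only `j = 0` constrains `α`.
    · have hconj : ∫ z : Circle, (starRingEnd ℂ) (z : ℂ) ∂μ = m := by
        rw [integral_conj, hm, hreal]
      have hpt : ∀ z : Circle, (starRingEnd ℂ) ((z : ℂ) ^ 1) *
          (X ^ 2 + C (-m + (starRingEnd ℂ) α * m) * X + C (-(starRingEnd ℂ) α)).eval (z : ℂ) =
          ((z : ℂ) + (-m + (starRingEnd ℂ) α * m)) +
            (-(starRingEnd ℂ) α) * (starRingEnd ℂ) (z : ℂ) := by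
        intro z
        have hz : (starRingEnd ℂ) (z : ℂ) * z = 1 := by
          rw [mul_comm, Complex.mul_conj, Circle.normSq_coe, Complex.ofReal_one]
        simp only [eval_add, eval_pow, eval_X, eval_mul, eval_C, pow_one]
        linear_combination ((z : ℂ) + (-m + (starRingEnd ℂ) α * m)) * hz
      simp_rw [hpt]
      rw [integral_add (Circle.integrable_of_continuous μ (by fun_prop))
        (Circle.integrable_of_continuous μ (by fun_prop)), integral_const_mul, hconj,
        integral_add (Circle.integrable_of_continuous μ (by fun_prop)) (integrable_const _), hm]
      simp
  · intro z hz
    simp only [eval_add, eval_sub, eval_pow, eval_X, eval_mul, eval_C, map_sub, map_div₀, map_one,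
      Complex.conj_conj, pow_one, hreal]
    field_simp
    ring

end Verblunsky

/-! ### Normalization and range of the second Szegő map -/

section SzegoMaps

theorem four_sub_sq_two_re_nonneg (z : Circle) : 0 ≤ 4 - (2 * (z : ℂ).re) ^ 2 := by
  nlinarith [z.re_sq_add_im_sq, sq_nonneg (z : ℂ).im]

theorem integral_four_sub_sq_pos {μ : Measure Circle} [IsFiniteMeasure μ]
    (hμ : IsNontrivialMeasure μ) : 0 < ∫ z : Circle, (4 - (2 * (z : ℂ).re) ^ 2) ∂μ := by
  refine Circle.integral_pos_of_finite_zeros hμ (by fun_prop) four_sub_sq_two_re_nonneg ?_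
  refine ((Circle.finite_setOf_re_eq 1).union (Circle.finite_setOf_re_eq (-1))).subset ?_
  intro z hz
  have hz' : 4 - (2 * (z : ℂ).re) ^ 2 = 0 := hz
  exact eq_or_eq_neg_of_sq_eq_sq _ _ (show (z : ℂ).re ^ 2 = 1 ^ 2 by linarith)

theorem integral_re_sq_lt_one {μ : Measure Circle} [IsProbabilityMeasure μ]
    (hμ : IsNontrivialMeasure μ) : (∫ z : Circle, (z : ℂ).re ∂μ) ^ 2 < 1 := by
  have hi := Circle.integrable_of_continuous μ (f := fun z : Circle => (z : ℂ).re) (by fun_prop)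
  have hre (z : Circle) : |(z : ℂ).re| ≤ 1 := by
    exact (Complex.abs_re_le_norm (z : ℂ)).trans_eq z.norm_coe
  have h1 : 0 < ∫ z : Circle, (1 - (z : ℂ).re) ∂μ := by
    refine Circle.integral_pos_of_finite_zeros hμ (by fun_prop)
      (fun z => by linarith [abs_le.1 (hre z)]) ((Circle.finite_setOf_re_eq 1).subset ?_)
    exact fun z hz => (sub_eq_zero.1 (show 1 - (z : ℂ).re = 0 from hz)).symm
  have h2 : 0 < ∫ z : Circle, (1 + (z : ℂ).re) ∂μ := by
    refine Circle.integral_pos_of_finite_zeros hμ (by fun_prop)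
      (fun z => by linarith [abs_le.1 (hre z)]) ((Circle.finite_setOf_re_eq (-1)).subset ?_)
    exact fun z hz => eq_neg_of_add_eq_zero_right (show 1 + (z : ℂ).re = 0 from hz)
  rw [integral_sub (integrable_const _) hi] at h1
  rw [integral_add (integrable_const _) hi] at h2
  simp only [integral_const, probReal_univ, smul_eq_mul, mul_one] at h1 h2
  nlinarith

/-- The constant in the second Szegő map normalizes it to a probability measure. -/
theorem szegoConst_sq {μ : Measure Circle} (hμ : μ ∈ evenMeasures) :
    szegoConst μ ^ 2 * ∫ z : Circle, (4 - (2 * (z : ℂ).re) ^ 2) ∂μ = 1 := by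
  obtain ⟨hp, hn, he⟩ := hμ
  set r := ∫ z : Circle, (z : ℂ).re ∂μ with hr
  set s := ∫ z : Circle, ((z : ℂ) ^ 2).re ∂μ with hs
  have hm1 : ∫ z : Circle, (z : ℂ) ∂μ = (r : ℂ) := by
    simpa using (ofReal_integral_re_of_even he 1).symm
  have hm2 : ∫ z : Circle, (z : ℂ) ^ 2 ∂μ = (s : ℂ) := (ofReal_integral_re_of_even he 2).symm
  have hr1 : r ^ 2 < 1 := integral_re_sq_lt_one hn
  have h0 : ‖verblunsky μ 0‖ ^ 2 = r ^ 2 := by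
    rw [← RCLike.norm_conj, verblunsky_zero, hm1, Complex.norm_real, Real.norm_eq_abs, sq_abs]
  have h1 : (verblunsky μ 1).re * (1 - r ^ 2) = s - r ^ 2 := by
    -- `verblunsky` is a choice, so existence comes first; nontriviality gives `r² < 1`, which
    -- permits the division.
    have hex : ∃ α, IsVerblunsky μ 1 α := by
      refine ⟨(((s - r ^ 2) / (1 - r ^ 2) : ℝ) : ℂ),
        isVerblunsky_one_of_mul_eq hm1 (Complex.conj_ofReal r) ?_⟩
      rw [hm2, Complex.conj_ofReal]
      norm_cast
      have : 1 - r ^ 2 ≠ 0 := by linarith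
      rw [← sq]
      field_simp
    have h := (Classical.epsilon_spec hex).one_mul_eq
    rw [hm1, hm2, Complex.conj_ofReal] at h
    have h' := congrArg Complex.re h
    norm_cast at h'
    rw [Complex.re_mul_ofReal, Complex.conj_re, ← sq] at h'
    exact h'
  have hI : ∫ z : Circle, (4 - (2 * (z : ℂ).re) ^ 2) ∂μ = 2 - 2 * s := by
    have hpt (z : Circle) : 4 - (2 * (z : ℂ).re) ^ 2 = 2 - 2 * ((z : ℂ) ^ 2).re := by
      rw [sq (z : ℂ), Complex.mul_re]
      nlinarith [z.re_sq_add_im_sq]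
    simp_rw [hpt]
    rw [integral_sub (integrable_const _) (Circle.integrable_of_continuous μ (by fun_prop)),
      integral_const_mul]
    simp [hs]
  have hpos := integral_four_sub_sq_pos hn
  rw [szegoConst, h0, ← Real.rpow_natCast, ← Real.rpow_mul, hI]
  · rw [hI] at hpos
    -- From `α₁ (1 - r²) = s - r²` it follows that `(1 - r²)(1 - α₁) = 1 - s`.
    have : 2 * (1 - r ^ 2) * (1 - (verblunsky μ 1).re) = 2 - 2 * s := by
      linear_combination -2 * h1
    rw [this]
    norm_num
    rw [Real.rpow_neg_one]
    exact inv_mul_cancel₀ hpos.ne'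
  · rw [hI] at hpos
    linarith

theorem measurable_two_re : Measurable fun z : Circle => 2 * (z : ℂ).re :=
  Continuous.measurable (by fun_prop)

theorem lintegral_four_sub_sq_Sz₁ {μ : Measure Circle} [IsFiniteMeasure μ] :
    ∫⁻ x, ENNReal.ofReal (4 - x ^ 2) ∂(Sz₁ μ) =
      ENNReal.ofReal (∫ z : Circle, (4 - (2 * (z : ℂ).re) ^ 2) ∂μ) := by
  rw [Sz₁, lintegral_map (by fun_prop) measurable_two_re,
    ofReal_integral_eq_lintegral_ofReal (Circle.integrable_of_continuous μ (by fun_prop))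
      (Filter.Eventually.of_forall four_sub_sq_two_re_nonneg)]

theorem Sz₂_eq_smul (μ : Measure Circle) :
    Sz₂ μ = ENNReal.ofReal (szegoConst μ ^ 2) •
      (Sz₁ μ).withDensity (fun x => ENNReal.ofReal (4 - x ^ 2)) := by
  rw [Sz₂, ← withDensity_smul _ (by fun_prop)]
  congr 1
  ext x
  rw [ENNReal.ofReal_mul (sq_nonneg _)]
  rfl

theorem Sz₂_univ {μ : Measure Circle} (hμ : μ ∈ evenMeasures) : Sz₂ μ Set.univ = 1 := by
  have := hμ.1
  rw [Sz₂_eq_smul, Measure.smul_apply, withDensity_apply _ MeasurableSet.univ,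
    Measure.restrict_univ, lintegral_four_sub_sq_Sz₁, smul_eq_mul,
    ← ENNReal.ofReal_mul (sq_nonneg _), szegoConst_sq hμ, ENNReal.ofReal_one]

theorem lintegral_inv_Sz₂_lt_top (μ : Measure Circle) [IsFiniteMeasure μ] (s : Set ℝ) :
    ∫⁻ x in s, (ENNReal.ofReal (4 - x ^ 2))⁻¹ ∂(Sz₂ μ) < ⊤ := by
  refine (setLIntegral_le_lintegral _ _).trans_lt ?_
  have : IsFiniteMeasure (Sz₁ μ) := by unfold Sz₁; infer_instance
  rw [Sz₂_eq_smul, lintegral_smul_measure,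
    lintegral_withDensity_eq_lintegral_mul _ (by fun_prop) (by fun_prop), smul_eq_mul]
  refine ENNReal.mul_lt_top ENNReal.ofReal_lt_top ?_
  -- At `x = ±2` the product is `0 * ⊤ = 0`, so an inequality is all that holds.
  calc _ ≤ ∫⁻ _, 1 ∂(Sz₁ μ) := lintegral_mono fun x => ENNReal.mul_inv_le_one _
    _ < ⊤ := by simp

/-- The even measure on the circle that projects to a given measure on `[-2, 2]`. -/
noncomputable def szegoLift (ν : Measure ℝ) : Measure Circle :=
  (2⁻¹ : ENNReal) • (ν.map (fun x => Circle.exp (Real.arccos (x / 2))) +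
    (ν.map fun x => Circle.exp (Real.arccos (x / 2))).map fun z => z⁻¹)

theorem measurable_exp_arccos : Measurable fun x : ℝ => Circle.exp (Real.arccos (x / 2)) :=
  Continuous.measurable (by fun_prop)

theorem measurable_circle_inv : Measurable fun z : Circle => z⁻¹ :=
  continuous_inv.measurable

theorem szegoLift_even (ν : Measure ℝ) : (szegoLift ν).map (fun z => z⁻¹) = szegoLift ν := by
  rw [szegoLift, Measure.map_smul, Measure.map_add _ _ measurable_circle_inv,
    Measure.map_map measurable_circle_inv measurable_circle_inv, add_comm]
  congr 2
  have : (fun z : Circle => z⁻¹) ∘ (fun z : Circle => z⁻¹) = id := by ext; simp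
  rw [this, Measure.map_id]

theorem Sz₁_szegoLift {ν : Measure ℝ} (hν : ν (Set.Icc (-2) 2)ᶜ = 0) :
    Sz₁ (szegoLift ν) = ν := by
  have h2 : (fun z : Circle => 2 * (z : ℂ).re) ∘ (fun z : Circle => z⁻¹) =
      fun z : Circle => 2 * (z : ℂ).re := by
    ext z; simp
  have h1 : (ν.map fun x => Circle.exp (Real.arccos (x / 2))).map
      (fun z : Circle => 2 * (z : ℂ).re) = ν := by
    rw [Measure.map_map measurable_two_re measurable_exp_arccos]
    conv_rhs => rw [← Measure.map_id (μ := ν)]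
    refine Measure.map_congr ?_
    filter_upwards [measure_eq_zero_iff_ae_notMem.1 hν] with x hx
    obtain ⟨ha, hb⟩ := not_not.1 hx
    rw [Function.comp_apply, Circle.coe_exp, Complex.exp_ofReal_mul_I_re,
      Real.cos_arccos (by linarith) (by linarith)]
    exact mul_div_cancel₀ x two_ne_zero
  rw [Sz₁, szegoLift, Measure.map_smul, Measure.map_add _ _ measurable_two_re,
    Measure.map_map measurable_two_re measurable_circle_inv, h2, h1, ← two_smul ENNReal ν,
    smul_smul, ENNReal.inv_mul_cancel two_ne_zero ENNReal.ofNat_ne_top, one_smul]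

theorem IsNontrivialMeasure.of_map {X Y : Type*} [MeasurableSpace X] [MeasurableSpace Y]
    [MeasurableSingletonClass Y] {μ : Measure X} {f : X → Y} (hf : Measurable f)
    (h : IsNontrivialMeasure (μ.map f)) : IsNontrivialMeasure μ := by
  intro S hS h0
  refine h (f '' S) (hS.image f) ?_
  rw [Measure.map_apply hf (hS.image f).measurableSet.compl]
  exact measure_mono_null (fun x hx hxS => hx ⟨x, hxS, rfl⟩) h0

theorem mem_ranSz₂_of_lintegral_lt_top {γ : Measure ℝ} [IsProbabilityMeasure γ]
    (hγ : IsNontrivialMeasure γ) (hsupp : γ (Set.Icc (-2 : ℝ) 2)ᶜ = 0)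
    (hfin : ∫⁻ x in Set.Icc (-2 : ℝ) 2, (ENNReal.ofReal (4 - x ^ 2))⁻¹ ∂γ < ⊤) :
    γ ∈ ranSz₂ := by
  have hres : γ.restrict (Set.Icc (-2 : ℝ) 2) = γ :=
    Measure.restrict_eq_self_of_ae_mem
      ((measure_eq_zero_iff_ae_notMem.1 hsupp).mono fun x hx => not_not.1 hx)
  rw [hres] at hfin
  set g : ℝ → ENNReal := fun x => (ENNReal.ofReal (4 - x ^ 2))⁻¹ with hg
  have hgm : Measurable g := by fun_prop
  set K := ∫⁻ x, g x ∂γ with hK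
  have hgpos (x : ℝ) : g x ≠ 0 := ENNReal.inv_ne_zero.2 ENNReal.ofReal_ne_top
  have hK0 : K ≠ 0 := by
    rw [hK, Ne, lintegral_eq_zero_iff hgm]
    intro h
    refine IsProbabilityMeasure.ne_zero γ (ae_eq_bot.1 (Filter.eventually_false_iff_eq_bot.1 ?_))
    exact h.mono fun x hx => hgpos x hx
  set ν : Measure ℝ := K⁻¹ • γ.withDensity g with hν
  have hνp : ν Set.univ = 1 := by
    rw [hν, Measure.smul_apply, withDensity_apply _ MeasurableSet.univ, Measure.restrict_univ,
      smul_eq_mul, ENNReal.inv_mul_cancel hK0 hfin.ne]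
  have hac : γ.withDensity g ≪ γ := withDensity_absolutelyContinuous _ _
  have hνs : ν (Set.Icc (-2) 2)ᶜ = 0 := by
    rw [hν, Measure.smul_apply, hac hsupp, smul_zero]
  have hνn : IsNontrivialMeasure ν := by
    intro S hS h0
    refine hγ S hS ?_
    rw [hν, Measure.smul_apply, smul_eq_mul, mul_eq_zero] at h0
    have h0' := h0.resolve_left (ENNReal.inv_ne_zero.2 hfin.ne)
    exact withDensity_absolutelyContinuous' hgm.aemeasurable
      (Filter.Eventually.of_forall hgpos) h0'
  have hSz₁ : Sz₁ (szegoLift ν) = ν := Sz₁_szegoLift hνs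
  have hμ : szegoLift ν ∈ evenMeasures := by
    refine ⟨⟨?_⟩, ?_, szegoLift_even ν⟩
    · rw [← hSz₁, Sz₁, Measure.map_apply measurable_two_re MeasurableSet.univ] at hνp
      exact hνp
    · rw [← hSz₁] at hνn
      exact IsNontrivialMeasure.of_map measurable_two_re hνn
  refine ⟨szegoLift ν, hμ, ?_⟩
  have hone : (γ.withDensity g).withDensity (fun x => ENNReal.ofReal (4 - x ^ 2)) = γ := by
    rw [← withDensity_mul _ hgm (by fun_prop)]
    conv_rhs => rw [← withDensity_one (μ := γ)]
    refine withDensity_congr_ae ?_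
    -- Finiteness of the integral leaves no mass where `4 - x²` truncates to 0, in particular at
    -- `±2`.
    filter_upwards [ae_lt_top hgm hfin.ne] with x hx
    exact ENNReal.inv_mul_cancel (ENNReal.inv_ne_top.1 hx.ne) ENNReal.ofReal_ne_top
  have hmul : Sz₂ (szegoLift ν) =
      (ENNReal.ofReal (szegoConst (szegoLift ν) ^ 2) * K⁻¹) • γ := by
    rw [Sz₂_eq_smul, hSz₁, hν, withDensity_smul_measure, hone, smul_smul]
  -- Both sides have mass one, which forces the constant to be 1.
  have huniv := Sz₂_univ hμ
  rw [hmul, Measure.smul_apply, measure_univ, smul_eq_mul, mul_one] at huniv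
  rw [hmul, huniv, one_smul]

end SzegoMaps

/-! ### Measures with a nonvanishing Jost function -/

section Jost

theorem IsJostFunction.singularPart_eq_zero {γ : Measure ℝ} {a b : ℕ → ℝ} {u : ℂ → ℂ}
    (h : IsJostFunction γ a b u) (hu : ∀ z ∈ Metric.closedBall (0 : ℂ) 1, u z ≠ 0) :
    γ.singularPart volume = 0 := by
  obtain ⟨S, hS, h0⟩ := h.singular
  suffices S = ∅ by simpa [this] using h0
  refine Finset.eq_empty_of_forall_notMem fun E hE => ?_
  obtain ⟨hE2, heig⟩ := hS E hE
  obtain ⟨z, hz0, hz1, hzE⟩ : ∃ z : ℝ, z ≠ 0 ∧ |z| < 1 ∧ z + z⁻¹ = E := by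
    -- The smaller root of `z² - F z + 1`; negative `E` follows by `z ↦ -z`.
    have key : ∀ F : ℝ, 2 < F → ∃ z : ℝ, z ≠ 0 ∧ |z| < 1 ∧ z + z⁻¹ = F := by
      intro F hF
      have hs : 0 < F ^ 2 - 4 := by nlinarith
      set q := Real.sqrt (F ^ 2 - 4)
      have hq : q ^ 2 = F ^ 2 - 4 := Real.sq_sqrt hs.le
      have hq0 : 0 < q := Real.sqrt_pos.2 hs
      have hqF : q < F := by nlinarith
      have hq2 : F - 2 < q := by nlinarith
      have hz : 0 < (F - q) / 2 := by linarith
      refine ⟨(F - q) / 2, hz.ne', by rw [abs_of_pos hz]; linarith, ?_⟩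
      have : F - q ≠ 0 := by linarith
      field_simp
      nlinarith
    rcases lt_or_ge 2 E with h2 | h2
    · exact key E h2
    · have : E < -2 := by
        by_contra hc
        exact hE2 ⟨not_lt.1 hc, h2⟩
      obtain ⟨z, h0, h1, hz⟩ := key (-E) (by linarith)
      exact ⟨-z, neg_ne_zero.2 h0, by rwa [abs_neg], by rw [inv_neg]; linarith⟩
  have hnorm : ‖(z : ℂ)‖ < 1 := by rwa [Complex.norm_real]
  refine hu z (by simpa using hnorm.le)
    ((h.zero_iff z hnorm (Complex.ofReal_ne_zero.2 hz0)).2 ?_)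
  have : (z : ℂ) + (z : ℂ)⁻¹ = (E : ℂ) := by rw [← hzE]; push_cast; rfl
  rwa [this]

theorem lintegral_inv_sqrt_four_sub_sq_lt_top :
    ∫⁻ x in Set.Icc (-2 : ℝ) 2, ENNReal.ofReal (1 / Real.sqrt (4 - x ^ 2)) < ⊤ := by
  have hint : IntegrableOn (fun x : ℝ => 1 / Real.sqrt (4 - x ^ 2)) (Set.Ioc (-2) 2) := by
    -- A nonnegative derivative of a function continuous up to the endpoints is integrable.
    refine intervalIntegral.integrableOn_deriv_of_nonneg (g := fun x => Real.arcsin (x / 2))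
      (by fun_prop) ?_ (fun x _ => by positivity)
    rintro x ⟨h1, h2⟩
    have := (Real.hasDerivAt_arcsin (x := x / 2) (by linarith) (by linarith)).comp x
      ((hasDerivAt_id x).div_const 2)
    refine this.congr_deriv ?_
    have hx : 4 - x ^ 2 = 2 ^ 2 * (1 - (x / 2) ^ 2) := by ring
    rw [hx, Real.sqrt_mul (by norm_num), Real.sqrt_sq (by norm_num)]
    ring
  have := ((integrableOn_Icc_iff_integrableOn_Ioc).2 hint).lintegral_lt_top
  exact this

theorem IsJostFunction.exists_density_bound {γ : Measure ℝ} {a b : ℕ → ℝ} {u : ℂ → ℂ}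
    (h : IsJostFunction γ a b u) (hcont : ContinuousOn u (Metric.closedBall 0 1))
    (hu : ∀ z ∈ Metric.closedBall (0 : ℂ) 1, u z ≠ 0) :
    ∃ (K : ℝ) (f : ℝ → ℝ), Measurable f ∧
      (∀ x ∈ Set.Icc (-2 : ℝ) 2, f x ≤ K * Real.sqrt (4 - x ^ 2)) ∧
      γ = (volume.restrict (Set.Icc (-2 : ℝ) 2)).withDensity (fun x => ENNReal.ofReal (f x)) := by
  obtain ⟨f, hf, hγ⟩ := h.density
  rw [h.singularPart_eq_zero hu, add_zero] at hγ
  have hmem (t : ℝ) : Complex.exp (t * Complex.I) ∈ Metric.closedBall (0 : ℂ) 1 := by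
    simp [Complex.norm_exp_ofReal_mul_I]
  obtain ⟨w, hw, hmin⟩ := (isCompact_closedBall (0 : ℂ) 1).exists_isMinOn
    ⟨0, by simp⟩ hcont.norm
  have hw0 : 0 < ‖u w‖ := norm_pos_iff.2 (hu w hw)
  have hcu : Continuous fun t : ℝ => u (Complex.exp (t * Complex.I)) :=
    hcont.comp_continuous (by fun_prop) hmem
  have hne (t : ℝ) : ‖u (Complex.exp (t * Complex.I))‖ ^ 2 ≠ 0 :=
    pow_ne_zero 2 (norm_ne_zero_iff.2 (hu _ (hmem t)))
  have hF : Continuous fun t : ℝ =>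
      1 / Real.pi * (|Real.sin t| / ‖u (Complex.exp (t * Complex.I))‖ ^ 2) :=
    continuous_const.mul (Real.continuous_sin.abs.div (hcu.norm.pow 2) hne)
  have hfx (x : ℝ) (hx : x ∈ Set.Icc (-2 : ℝ) 2) :
      2 * Real.cos (Real.arccos (x / 2)) = x := by
    rw [Real.cos_arccos (by linarith [hx.1]) (by linarith [hx.2])]
    ring
  -- `f` is unconstrained off `[-2, 2]`; composing with the clamp `2 cos (arccos (x / 2))` makes it
  -- continuous. The 2 in the constant comes from `sin θ = √(4 - x²) / 2`.
  refine ⟨1 / (2 * Real.pi * ‖u w‖ ^ 2), fun x => f (2 * Real.cos (Real.arccos (x / 2))),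
    ?_, fun x _ => ?_, ?_⟩
  · simp_rw [hf]
    exact (hF.comp (Real.continuous_arccos.comp (continuous_id.div_const 2))).measurable
  · have hsqrt : Real.sqrt (4 - x ^ 2) = 2 * Real.sqrt (1 - (x / 2) ^ 2) := by
      have hx : 4 - x ^ 2 = 2 ^ 2 * (1 - (x / 2) ^ 2) := by ring
      rw [hx, Real.sqrt_mul (by norm_num), Real.sqrt_sq (by norm_num)]
    beta_reduce
    rw [hf, Real.sin_arccos, abs_of_nonneg (Real.sqrt_nonneg _), hsqrt]
    have hle := hmin (hmem (Real.arccos (x / 2)))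
    calc _ ≤ 1 / Real.pi * (Real.sqrt (1 - (x / 2) ^ 2) / ‖u w‖ ^ 2) := by
          gcongr
          exact hle
      _ = _ := by field_simp
  · conv_lhs => rw [hγ]
    refine withDensity_congr_ae ?_
    filter_upwards [ae_restrict_mem measurableSet_Icc] with x hx
    rw [hfx x hx]

theorem IsJostFunction.lintegral_inv_lt_top {γ : Measure ℝ} {a b : ℕ → ℝ} {u : ℂ → ℂ}
    (h : IsJostFunction γ a b u) (hcont : ContinuousOn u (Metric.closedBall 0 1))
    (hu : ∀ z ∈ Metric.closedBall (0 : ℂ) 1, u z ≠ 0) :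
    ∫⁻ x in Set.Icc (-2 : ℝ) 2, (ENNReal.ofReal (4 - x ^ 2))⁻¹ ∂γ < ⊤ := by
  obtain ⟨K, f, hfm, hfK, rfl⟩ := h.exists_density_bound hcont hu
  refine (setLIntegral_le_lintegral _ _).trans_lt ?_
  rw [lintegral_withDensity_eq_lintegral_mul _ (by fun_prop) (by fun_prop)]
  refine lt_of_le_of_lt ?_ (ENNReal.mul_lt_top (ENNReal.ofReal_lt_top (r := K))
    lintegral_inv_sqrt_four_sub_sq_lt_top)
  -- The null endpoints, where the inverse is `⊤`, are dropped.
  rw [← lintegral_const_mul _ (by fun_prop), Measure.restrict_congr_set Ioo_ae_eq_Icc.symm]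
  refine setLIntegral_mono (by fun_prop) fun x hx => ?_
  have hpos : 0 < 4 - x ^ 2 := by nlinarith [hx.1, hx.2]
  have hs : 0 < Real.sqrt (4 - x ^ 2) := Real.sqrt_pos.2 hpos
  rw [Pi.mul_apply, ← ENNReal.ofReal_inv_of_pos hpos,
    ← ENNReal.ofReal_mul' (inv_nonneg.2 hpos.le), ← ENNReal.ofReal_mul' (by positivity)]
  refine ENNReal.ofReal_le_ofReal ?_
  calc f x * (4 - x ^ 2)⁻¹ ≤ K * Real.sqrt (4 - x ^ 2) * (4 - x ^ 2)⁻¹ := by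
        gcongr
        exact hfK x (Set.Ioo_subset_Icc_self hx)
    _ = K * (1 / Real.sqrt (4 - x ^ 2)) := by
        nth_rewrite 2 [← Real.mul_self_sqrt hpos.le]
        field_simp

theorem isNontrivialMeasure_of_absolutelyContinuous {γ : Measure ℝ} [NeZero γ]
    (h : γ ≪ volume) : IsNontrivialMeasure γ := by
  intro S hS h0
  refine NeZero.ne γ (Measure.measure_univ_eq_zero.1 ?_)
  rw [← Set.union_compl_self S]
  exact measure_union_null (h (hS.measure_zero volume)) h0

end Jost

theorem proposition3p1 :
    (∀ (γ : Measure ℝ) (a b : ℕ → ℝ) (u : ℂ → ℂ),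
      IsProbabilityMeasure γ → IsJacobiParameters γ a b → IsJostFunction γ a b u →
      AnalyticOnNhd ℂ u (Metric.closedBall 0 1) →
      (∀ z ∈ Metric.closedBall (0 : ℂ) 1, u z ≠ 0) →
      γ ∈ ranSz₂ ∧
        ∫⁻ x in Set.Icc (-2 : ℝ) 2, (ENNReal.ofReal (4 - x ^ 2))⁻¹ ∂γ < ⊤) ∧
    (∀ γ : Measure ℝ, IsProbabilityMeasure γ → IsNontrivialMeasure γ →
      γ (Set.Icc (-2 : ℝ) 2)ᶜ = 0 →
      (γ ∈ ranSz₂ ↔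
        ∫⁻ x in Set.Icc (-2 : ℝ) 2, (ENNReal.ofReal (4 - x ^ 2))⁻¹ ∂γ < ⊤)) := by
  refine ⟨fun γ a b u _ _ hJ hu hne => ?_, fun γ _ hn hs => ⟨?_, ?_⟩⟩
  · have hfin := hJ.lintegral_inv_lt_top hu.continuousOn hne
    obtain ⟨K, f, -, -, hγ⟩ := hJ.exists_density_bound hu.continuousOn hne
    have hac : γ ≪ volume.restrict (Set.Icc (-2 : ℝ) 2) :=
      hγ ▸ withDensity_absolutelyContinuous _ _
    refine ⟨mem_ranSz₂_of_lintegral_lt_top ?_ (hac ?_) hfin, hfin⟩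
    · exact isNontrivialMeasure_of_absolutelyContinuous
        (hac.trans Measure.absolutelyContinuous_restrict)
    · rw [Measure.restrict_apply measurableSet_Icc.compl, Set.compl_inter_self, measure_empty]
  · rintro ⟨μ, hμ, rfl⟩
    have := hμ.1
    exact lintegral_inv_Sz₂_lt_top μ _
  · exact mem_ranSz₂_of_lintegral_lt_top hn hs
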